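/- Let $d$ be a non-negative integer or $d=\infty$ (countable infinity), let $\mathbb{C}^d$ be the $d$-dimensional complex Hilbert space ($\ell^2(\mathbb{N})$ if $d=\infty$), with inner product linear in the first variable, and let $\mathbb{B}_d$ be its open unit ball. The Drury–Arveson space $H^2_d$ is the Hilbert space of functions $f:\mathbb{B}_d\to\mathbb{C}$ given by power series $f(z)=\sum_\alpha c_\alpha z^\alpha$ (over finitely supported multi-indices $\alpha$) with $$\|f\|^2=\sum_\alpha |c_\alpha|^2\,\frac{\alpha!}{|\alpha|!}<\infty .$$ It is a Hilbert function space on $\mathbb{B}_d$ with reproducing kernel $k(z,w)=\dfrac{1}{1-\langle z,w\rangle}$. A function $\varphi:\mathbb{B}_d\to\mathbb{C}$ is a multiplier of $H^2_d$ if $\varphi h\in H^2_d$ for all $h\in H^2_d$. A contractive $M_m(\mathbb{C})$-valued multiplier is a function $\Phi=[\varphi_{ab}]_{a,b=1}^m:\mathbb{B}_d\to M_m(\mathbb{C})$ whose entries are multipliers of $H^2_d$ and for which the operator $M_\Phi:h\mapsto \Phi h$ on $H^2_d\otimes\mathbb{C}^m$ has norm at most $1$. **Theorem.** The Drury–Arveson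 space $H^2_d$ has the complete Pick property: for all $m,n\in\mathbb{N}$, all points $x_1,\dots,x_n\in\mathbb{B}_d$ (not necessarily distinct) and all matrices $W_1,\dots,W_n\in M_m(\mathbb{C})$, the following two conditions are equivalent: 1. there is a contractive $M_m(\mathbb{C})$-valued multiplier $\Phi$ of $H^2_d$ such that $\Phi(x_i)=W_i$ for all $i=1,\dots,n$; 2. the $mn\times mn$ block matrix whose $m\times m$ block in block row $j$ and block column $i$ is $(I-W_jW_i^*)\,k(x_j,x_i)$, $i,j=1,\dots,n$, is positive semi-definite. -/

import Mathlib

noncomputable section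

open scoped ComplexOrder

/-! ### Complete Pick spaces -/

section Pick

variable {X : Type*} (H : Type*) [NormedAddCommGroup H] [InnerProductSpace ℂ H] [RKHS ℂ H X ℂ]

/-- `φ` is a (scalar) multiplier of the Hilbert function space `H`: `φ h ∈ H` for all `h ∈ H`. -/
def IsMultiplier (φ : X → ℂ) : Prop :=
  ∀ h : H, ∃ g : H, ∀ x, g x = φ x * h x

/-- `Φ ∈ Mult(H) ⊗ M_m(ℂ)`, and the multiplication operator `h ↦ Φ h` on
`H ⊗ ℂᵐ` (the Hilbert direct sum of `m` copies of `H`) has norm at most one. -/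
def IsContractiveMultiplier {m : ℕ} (Φ : X → Matrix (Fin m) (Fin m) ℂ) : Prop :=
  (∀ a b, IsMultiplier H fun x => Φ x a b) ∧
    ∀ h g : PiLp 2 (fun _ : Fin m => H),
      (∀ x a, g a x = ∑ b, Φ x a b * h b x) → ‖g‖ ≤ ‖h‖

/-- The Pick matrix, of size `nm × nm`: its `m × m` block in block row `j` and block column `i` is
`K(x j, x i) (I - W j (W i)ᴴ)`, where `K` is the reproducing kernel of `H`. -/
def pickMatrix [CompleteSpace H] {m n : ℕ} (x : Fin n → X)
    (W : Fin n → Matrix (Fin m) (Fin m) ℂ) : Matrix (Fin n × Fin m) (Fin n × Fin m) ℂ :=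
  Matrix.of fun p q =>
    (1 - W p.1 * (W q.1).conjTranspose) p.2 q.2 * RKHS.kernel H (x p.1) (x q.1) 1

/-- The complete Pick property of a Hilbert function space. -/
def HasCompletePickProperty [CompleteSpace H] : Prop :=
  ∀ (m n : ℕ) (x : Fin n → X) (W : Fin n → Matrix (Fin m) (Fin m) ℂ),
    (∃ Φ : X → Matrix (Fin m) (Fin m) ℂ, IsContractiveMultiplier H Φ ∧ ∀ i, Φ (x i) = W i) ↔
      (pickMatrix H x W).PosSemidef

end Pick

/-! ### The Drury–Arveson space -/

/-- The open unit ball of the Hilbert space `ℓ²(ι)` (`ℂᵈ` when `ι` has `d` elements). -/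
abbrev DABall (ι : Type*) : Type _ :=
  ↥(Metric.ball (0 : lp (fun _ : ι => ℂ) 2) 1)

/-- The monomial `z ^ α`. -/
def daMonomial {ι : Type*} (α : ι →₀ ℕ) (z : ι → ℂ) : ℂ :=
  α.prod fun i k => z i ^ k

/-- The Drury–Arveson space `H²_d`, `d` being the cardinality of `ι`: power series
`f(z) = ∑ c_α z ^ α` with `‖f‖² = ∑ |c_α|² α! / |α|! < ∞`. An element is stored through its
coordinates `√(α! / |α|!) c_α` in the orthonormal basis of normalized monomials;
see `DruryArveson.coeff` and `DruryArveson.hasSum_norm_sq`. -/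
def DruryArveson (ι : Type*) : Type _ := lp (fun _ : ι →₀ ℕ => ℂ) 2

namespace DruryArveson

variable {ι : Type*}

instance : NormedAddCommGroup (DruryArveson ι) :=
  inferInstanceAs (NormedAddCommGroup (lp (fun _ : ι →₀ ℕ => ℂ) 2))

instance : InnerProductSpace ℂ (DruryArveson ι) :=
  inferInstanceAs (InnerProductSpace ℂ (lp (fun _ : ι →₀ ℕ => ℂ) 2))

instance : CompleteSpace (DruryArveson ι) :=
  inferInstanceAs (CompleteSpace (lp (fun _ : ι →₀ ℕ => ℂ) 2))

/-- The coordinates of `f` in the orthonormal basis of normalized monomials. -/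
def coord (f : DruryArveson ι) : (ι →₀ ℕ) → ℂ :=
  (show lp (fun _ : ι →₀ ℕ => ℂ) 2 from f : (ι →₀ ℕ) → ℂ)

/-- The Taylor coefficient `c_α` of `f`; here `α.multinomial = |α|! / α!`. -/
def coeff (f : DruryArveson ι) (α : ι →₀ ℕ) : ℂ :=
  (√(α.multinomial : ℝ) : ℂ) * coord f α

theorem multinomial_pos' (α : ι →₀ ℕ) : (0 : ℝ) < α.multinomial := by
  rw [Finsupp.multinomial_eq]
  exact_mod_cast Nat.multinomial_pos _ _

theorem hasSum_norm_sq (f : DruryArveson ι) :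
    HasSum (fun α => ‖coeff f α‖ ^ 2 * (α.multinomial : ℝ)⁻¹) (‖f‖ ^ 2) := by
  have h := lp.hasSum_norm (p := 2) (by norm_num)
    (show lp (fun _ : ι →₀ ℕ => ℂ) 2 from f)
  have h2 : HasSum (fun α => ‖coord f α‖ ^ 2) (‖f‖ ^ 2) := by
    simpa using! h
  convert h2 using 2 with α
  have := multinomial_pos' α
  rw [coeff, norm_mul, mul_pow, Complex.norm_real, Real.norm_eq_abs, sq_abs,
    Real.sq_sqrt this.le]
  field_simp

/-- The multinomial theorem. -/
theorem sum_finsuppAntidiag [DecidableEq ι] {R : Type*} [CommSemiring R] (S : Finset ι) (n : ℕ)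
    (u : ι → R) :
    ∑ α ∈ S.finsuppAntidiag n, (α.multinomial : R) * α.prod (fun i k => u i ^ k)
      = (∑ i ∈ S, u i) ^ n := by
  rw [Finset.sum_pow_eq_sum_piAntidiag]
  refine Finset.sum_bij (fun α _ => ⇑α) ?_ ?_ ?_ ?_
  · intro α hα
    rw [Finset.mem_finsuppAntidiag] at hα
    rw [Finset.mem_piAntidiag]
    exact ⟨hα.1, fun i hi => hα.2 (by simpa using hi)⟩
  · intro α _ β _ h
    exact DFunLike.coe_injective h
  · intro k hk
    rw [Finset.mem_piAntidiag] at hk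
    refine ⟨Finsupp.onFinset S k hk.2, ?_, rfl⟩
    rw [Finset.mem_finsuppAntidiag]
    exact ⟨hk.1, Finsupp.support_onFinset_subset⟩
  · intro α hα
    rw [Finset.mem_finsuppAntidiag] at hα
    rw [Finsupp.multinomial_eq_of_support_subset hα.2,
      Finsupp.prod_of_support_subset _ hα.2 _ (by simp)]

theorem sum_biUnion_finsuppAntidiag [DecidableEq ι] {R : Type*} [CommSemiring R]
    (S : Finset ι) (N : ℕ) (u : ι → R) :
    ∑ α ∈ (Finset.range N).biUnion (fun n => S.finsuppAntidiag n),
      (α.multinomial : R) * α.prod (fun i k => u i ^ k)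
      = ∑ n ∈ Finset.range N, (∑ i ∈ S, u i) ^ n := by
  rw [Finset.sum_biUnion]
  · exact Finset.sum_congr rfl fun n _ => sum_finsuppAntidiag S n u
  · intro a _ b _ hab
    refine Finset.disjoint_left.2 fun α h1 h2 => hab ?_
    rw [Finset.mem_finsuppAntidiag] at h1 h2
    exact h1.1.symm.trans h2.1

theorem subset_biUnion_finsuppAntidiag [DecidableEq ι] (F : Finset (ι →₀ ℕ)) :
    ∃ (S : Finset ι) (N : ℕ), ∀ S' N', S ≤ S' → N ≤ N' →
      F ⊆ (Finset.range N').biUnion (fun n => S'.finsuppAntidiag n) := by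
  refine ⟨F.biUnion Finsupp.support, (F.sup fun α => α.sum fun _ k => k) + 1, ?_⟩
  intro S' N' hS hN α hα
  rw [Finset.mem_biUnion]
  refine ⟨α.sum fun _ k => k, ?_, ?_⟩
  · rw [Finset.mem_range]
    have := Finset.le_sup (f := fun α : ι →₀ ℕ => α.sum fun _ k => k) hα
    exact lt_of_lt_of_le (Nat.lt_succ_of_le this) hN
  · rw [Finset.mem_finsuppAntidiag']
    exact ⟨rfl, (Finset.subset_biUnion_of_mem Finsupp.support hα).trans hS⟩

theorem summable_multinomial (x : ι → ℝ) (hx : ∀ i, 0 ≤ x i) (hs : Summable x)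
    (h1 : ∑' i, x i < 1) :
    Summable fun α : ι →₀ ℕ => (α.multinomial : ℝ) * α.prod (fun i k => x i ^ k) := by
  classical
  refine summable_of_sum_le (c := (1 - ∑' i, x i)⁻¹) ?_ ?_
  · intro α
    exact mul_nonneg (Nat.cast_nonneg _) (Finset.prod_nonneg fun i _ => pow_nonneg (hx i) _)
  · intro F
    obtain ⟨S, N, h⟩ := subset_biUnion_finsuppAntidiag F
    have hT : 0 ≤ ∑' i, x i := tsum_nonneg hx
    calc _ ≤ _ := Finset.sum_le_sum_of_subset_of_nonneg (h S N le_rfl le_rfl) (fun α _ _ =>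
            mul_nonneg (Nat.cast_nonneg _) (Finset.prod_nonneg fun i _ => pow_nonneg (hx i) _))
      _ = ∑ n ∈ Finset.range N, (∑ i ∈ S, x i) ^ n := sum_biUnion_finsuppAntidiag S N x
      _ ≤ ∑ n ∈ Finset.range N, (∑' i, x i) ^ n := by
          gcongr with n _
          · exact Finset.sum_nonneg fun i _ => hx i
          · exact hs.sum_le_tsum _ fun i _ => hx i
      _ ≤ ∑' n : ℕ, (∑' i, x i) ^ n :=
          (summable_geometric_of_lt_one hT h1).sum_le_tsum _ fun n _ => pow_nonneg hT n
      _ = _ := tsum_geometric_of_lt_one hT h1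

theorem hasSum_multinomial (u : ι → ℂ) (hs : Summable fun i => ‖u i‖) (h1 : ∑' i, ‖u i‖ < 1) :
    HasSum (fun α : ι →₀ ℕ => (α.multinomial : ℂ) * α.prod (fun i k => u i ^ k))
      (1 - ∑' i, u i)⁻¹ := by
  classical
  have hsum : Summable
      (fun α : ι →₀ ℕ => (α.multinomial : ℂ) * α.prod (fun i k => u i ^ k)) := by
    refine Summable.of_norm ?_
    convert summable_multinomial (fun i => ‖u i‖) (fun i => norm_nonneg _) hs h1 using 2 with α
    simp [Finsupp.prod, norm_prod]
  obtain ⟨a, ha⟩ := hsum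
  have ht : Filter.Tendsto (fun p : Finset ι × ℕ =>
      (Finset.range p.2).biUnion (fun n => p.1.finsuppAntidiag n)) Filter.atTop Filter.atTop := by
    refine Filter.tendsto_atTop.2 fun F => ?_
    obtain ⟨S, N, h⟩ := subset_biUnion_finsuppAntidiag F
    filter_upwards [Filter.eventually_ge_atTop (S, N)] with p hp
    exact h _ _ hp.1 hp.2
  have h2 := ha.comp ht
  have h3 : Filter.Tendsto (fun p : Finset ι × ℕ => (∑ i ∈ p.1, u i) ^ p.2)
      Filter.atTop (nhds 0) := by
    have hT : 0 ≤ ∑' i, ‖u i‖ := tsum_nonneg fun i => norm_nonneg _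
    have h4 : Filter.Tendsto (fun p : Finset ι × ℕ => (∑' i, ‖u i‖) ^ p.2)
        Filter.atTop (nhds 0) :=
      (tendsto_pow_atTop_nhds_zero_of_lt_one hT h1).comp
        (by rw [← Filter.prod_atTop_atTop_eq]; exact Filter.tendsto_snd)
    refine squeeze_zero_norm (fun p => ?_) h4
    rw [norm_pow]
    gcongr
    exact (norm_sum_le _ _).trans (hs.sum_le_tsum _ fun i _ => norm_nonneg _)
  have h5 : Filter.Tendsto (fun p : Finset ι × ℕ => ∑ i ∈ p.1, u i)
      Filter.atTop (nhds (∑' i, u i)) :=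
    (hs.of_norm.hasSum).comp
      (by rw [← Filter.prod_atTop_atTop_eq]; exact Filter.tendsto_fst)
  have hne : ∀ t : ℂ, ‖t‖ < 1 → 1 - t ≠ 0 := by
    intro t ht h0
    have : t = 1 := (sub_eq_zero.1 h0).symm
    simp [this] at ht
  have hlt : ‖∑' i, u i‖ < 1 := (norm_tsum_le_tsum_norm hs).trans_lt h1
  have h6 : Filter.Tendsto (fun p : Finset ι × ℕ =>
      (1 - (∑ i ∈ p.1, u i) ^ p.2) * (1 - ∑ i ∈ p.1, u i)⁻¹) Filter.atTop
      (nhds ((1 - 0) * (1 - ∑' i, u i)⁻¹)) :=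
    (h3.const_sub 1).mul ((h5.const_sub 1).inv₀ (hne _ hlt))
  have h7 : a = (1 - 0) * (1 - ∑' i, u i)⁻¹ := by
    refine tendsto_nhds_unique h2 (h6.congr fun p => ?_)
    simp only [Function.comp]
    rw [sum_biUnion_finsuppAntidiag]
    have : ‖∑ i ∈ p.1, u i‖ < 1 :=
      ((norm_sum_le _ _).trans (hs.sum_le_tsum _ fun i _ => norm_nonneg _)).trans_lt h1
    rw [← mul_neg_geom_sum, mul_comm, ← mul_assoc, inv_mul_cancel₀ (hne _ this), one_mul]
  rw [sub_zero, one_mul] at h7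
  exact h7 ▸ ha

theorem ball_hasSum (z : DABall ι) : HasSum (fun i => ‖z.1 i‖ ^ 2) (‖z.1‖ ^ 2) := by
  simpa using! lp.hasSum_norm (p := 2) (by norm_num) z.1

theorem ball_norm_sq_lt (z : DABall ι) : ‖z.1‖ ^ 2 < 1 := by
  have : ‖z.1‖ < 1 := mem_ball_zero_iff.1 z.2
  exact pow_lt_one₀ (norm_nonneg _) this two_ne_zero

theorem memℓp_ker (z : DABall ι) :
    Memℓp (fun α : ι →₀ ℕ => (√(α.multinomial : ℝ) : ℂ) * star (daMonomial α z.1)) 2 := by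
  refine memℓp_gen ?_
  have h := ball_hasSum z
  convert summable_multinomial (fun i => ‖z.1 i‖ ^ 2) (fun i => by positivity) h.summable
    (h.tsum_eq ▸ ball_norm_sq_lt z) using 2 with α
  have := multinomial_pos' α
  simp only [ENNReal.toReal_ofNat, Real.rpow_ofNat]
  rw [norm_mul, mul_pow, Complex.norm_real, Real.norm_eq_abs, sq_abs,
    Real.sq_sqrt this.le, norm_star, daMonomial, Finsupp.prod, norm_prod, ← Finset.prod_pow]
  simp only [Finsupp.prod, norm_pow]
  congr 1
  exact Finset.prod_congr rfl fun i _ => by ring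

/-- The coordinates of the kernel function at `z`. -/
def ker (z : DABall ι) : DruryArveson ι :=
  (⟨_, memℓp_ker z⟩ : lp (fun _ : ι →₀ ℕ => ℂ) 2)

theorem hasSum_inner_ker (z : DABall ι) (f : DruryArveson ι) :
    HasSum (fun α => coeff f α * daMonomial α z.1) (inner ℂ (ker z) f) := by
  have h := lp.hasSum_inner (𝕜 := ℂ) (show lp (fun _ : ι →₀ ℕ => ℂ) 2 from ker z)
    (show lp (fun _ : ι →₀ ℕ => ℂ) 2 from f)
  refine (congrArg (HasSum · _) (funext fun α => ?_)).mp h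
  change inner ℂ ((√(Finsupp.multinomial α : ℝ) : ℂ) * star (daMonomial α z.1)) (coord f α) = _
  simp [coeff]
  ring

/-- A power series in `H²_d`, as a function on the ball. -/
def toFun (f : DruryArveson ι) (z : DABall ι) : ℂ :=
  ∑' α, coeff f α * daMonomial α z.1

theorem toFun_eq (f : DruryArveson ι) (z : DABall ι) : toFun f z = inner ℂ (ker z) f :=
  (hasSum_inner_ker z f).tsum_eq

theorem hasSum_toFun (f : DruryArveson ι) (z : DABall ι) :
    HasSum (fun α => coeff f α * daMonomial α z.1) (toFun f z) := by
  rw [toFun_eq]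
  exact hasSum_inner_ker z f

/-- The homogeneous parts of a power series in `H²_d` that vanishes on the ball vanish. -/
theorem homogeneous_eq_zero [DecidableEq ι] (f : DruryArveson ι) (hf : ∀ z, toFun f z = 0)
    (S : Finset ι) (v : ι → ℂ) (n : ℕ) :
    ∑ α ∈ S.finsuppAntidiag n, coeff f α * daMonomial α v = 0 := by
  set c : ℕ → ℂ := fun n => ∑ α ∈ S.finsuppAntidiag n, coeff f α * daMonomial α v with hc
  let y : lp (fun _ : ι => ℂ) 2 := ∑ i ∈ S, lp.single 2 i (v i)
  have hy : ∀ i, y i = if i ∈ S then v i else 0 := by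
    intro i
    simp only [y, lp.coeFn_sum, Finset.sum_apply, lp.single_apply]
    simp [Pi.single_apply]
  have hsum : ∀ t : ℂ, ‖t • y‖ < 1 → HasSum (fun n => t ^ n * c n) 0 := by
    intro t ht
    have h := hasSum_toFun f ⟨t • y, mem_ball_zero_iff.2 ht⟩
    rw [hf] at h
    have h2 := h.tsum_fiberwise (fun α : ι →₀ ℕ => α.sum fun _ k => k)
    refine (congrArg (HasSum · 0) (funext fun n => Eq.symm ?_)).mp h2
    rw [tsum_subtype ((fun α : ι →₀ ℕ => α.sum fun _ k => k) ⁻¹' {n})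
      (fun α => coeff f α * daMonomial α (t • y : lp (fun _ : ι => ℂ) 2)),
      tsum_eq_sum (s := S.finsuppAntidiag n), hc, Finset.mul_sum]
    · refine Finset.sum_congr rfl fun α hα => ?_
      rw [Finset.mem_finsuppAntidiag'] at hα
      rw [Set.indicator_of_mem (by simpa using hα.1)]
      have : daMonomial α (t • y : lp (fun _ : ι => ℂ) 2) = t ^ n * daMonomial α v := by
        rw [daMonomial, daMonomial, Finsupp.prod, Finsupp.prod, ← hα.1, Finsupp.sum,
          ← Finset.prod_pow_eq_pow_sum, ← Finset.prod_mul_distrib]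
        refine Finset.prod_congr rfl fun i hi => ?_
        rw [lp.coeFn_smul, Pi.smul_apply, hy, if_pos (hα.2 hi), smul_eq_mul, mul_pow]
      rw [this]
      ring
    · intro α hα
      by_cases hn : α ∈ (fun α : ι →₀ ℕ => α.sum fun _ k => k) ⁻¹' {n}
      · rw [Set.indicator_of_mem hn]
        rw [Finset.mem_finsuppAntidiag'] at hα
        have : ¬ α.support ⊆ S := fun h => hα ⟨by simpa using hn, h⟩
        obtain ⟨i, hi, hiS⟩ := Finset.not_subset.1 this
        rw [daMonomial, Finsupp.prod, Finset.prod_eq_zero hi, mul_zero]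
        rw [lp.coeFn_smul, Pi.smul_apply, hy, if_neg hiS, smul_zero]
        exact zero_pow (Finsupp.mem_support_iff.1 hi)
      · exact Set.indicator_of_notMem hn _
  have hp : HasFPowerSeriesAt (0 : ℂ → ℂ) (FormalMultilinearSeries.ofScalars ℂ c) 0 := by
    rw [hasFPowerSeriesAt_iff]
    have hcont : Continuous fun t : ℂ => ‖t • y‖ := by fun_prop
    have : ∀ᶠ t in nhds (0 : ℂ), ‖t • y‖ < 1 :=
      hcont.continuousAt.eventually_lt continuousAt_const (by simp)
    filter_upwards [this] with t ht
    simpa [FormalMultilinearSeries.coeff_ofScalars] using hsum t ht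
  have h0 := hp.eq_zero
  have := congrArg (fun p => FormalMultilinearSeries.coeff p n) h0
  simp only [FormalMultilinearSeries.coeff_ofScalars] at this
  exact this.trans rfl

theorem eq_zero_of_toFun (f : DruryArveson ι) (hf : ∀ z, toFun f z = 0) : f = 0 := by
  classical
  have hcoeff : ∀ α, coeff f α = 0 := by
    intro α
    let n := α.sum fun _ k => k
    let P : MvPolynomial ι ℂ :=
      ∑ β ∈ α.support.finsuppAntidiag n, MvPolynomial.monomial β (coeff f β)
    have hP : P = 0 := by
      refine MvPolynomial.funext fun v => ?_
      have := homogeneous_eq_zero f hf α.support v n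
      simpa [P, MvPolynomial.eval_monomial, daMonomial] using this
    have h2 := congrArg (MvPolynomial.coeff α) hP
    simpa [P, MvPolynomial.coeff_sum, MvPolynomial.coeff_monomial,
      Finset.mem_finsuppAntidiag, n, Finsupp.sum] using h2
  have h := hasSum_norm_sq f
  simp only [hcoeff, norm_zero, ne_eq, OfNat.ofNat_ne_zero, not_false_eq_true, zero_pow,
    zero_mul] at h
  have := h.unique hasSum_zero
  simpa using this

/-- `H²_d` as a Hilbert function space on the ball, through `f ↦ (z ↦ ∑ c_α z ^ α)`. -/
instance : RKHS ℂ (DruryArveson ι) (DABall ι) ℂ where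
  coeCLM :=
    { toFun := toFun
      map_add' := fun f g => by
        ext z
        simp [toFun_eq]
      map_smul' := fun a f => by
        ext z
        simp [toFun_eq]
      cont := by
        refine continuous_pi fun z => ?_
        simp only [toFun_eq]
        fun_prop }
  coeCLM_injective := by
    refine (injective_iff_map_eq_zero _).2 fun f h => ?_
    exact eq_zero_of_toFun f fun z => congrFun h z

theorem hasSum_apply (f : DruryArveson ι) (z : DABall ι) :
    HasSum (fun α => coeff f α * daMonomial α z.1) (f z) :=
  hasSum_toFun f z

/-- The reproducing kernel of `H²_d` is `1 / (1 - ⟨z, w⟩)`; Mathlib's inner product is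
conjugate-linear in its first argument. -/
theorem kernel_apply_one (z w : DABall ι) :
    RKHS.kernel (DruryArveson ι) z w 1 = 1 / (1 - inner ℂ w.1 z.1) := by
  have hker : RKHS.kerFun (DruryArveson ι) w 1 = ker w := by
    refine ext_inner_right ℂ fun f => ?_
    rw [RKHS.kerFun_inner, ← toFun_eq]
    simp
    rfl
  have h1 : RKHS.kernel (DruryArveson ι) z w 1 = toFun (ker w) z := by
    rw [← RKHS.kerFun_apply, hker]
    rfl
  have hin := lp.hasSum_inner (𝕜 := ℂ) w.1 z.1
  have hz := ball_hasSum z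
  have hw := ball_hasSum w
  have hbd : ∀ i, ‖inner ℂ (w.1 i) (z.1 i)‖ ≤ (‖z.1 i‖ ^ 2 + ‖w.1 i‖ ^ 2) / 2 := by
    intro i
    refine (norm_inner_le_norm _ _).trans ?_
    nlinarith [sq_nonneg (‖z.1 i‖ - ‖w.1 i‖)]
  have hmaj := (hz.add hw).div_const 2
  have hs : Summable fun i => ‖inner ℂ (w.1 i) (z.1 i)‖ :=
    Summable.of_nonneg_of_le (fun i => norm_nonneg _) hbd hmaj.summable
  have hlt : ∑' i, ‖inner ℂ (w.1 i) (z.1 i)‖ < 1 := by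
    refine (hs.tsum_le_tsum hbd hmaj.summable).trans_lt ?_
    rw [hmaj.tsum_eq]
    linarith [ball_norm_sq_lt z, ball_norm_sq_lt w]
  have h2 := hasSum_multinomial (fun i => inner ℂ (w.1 i) (z.1 i)) hs hlt
  rw [hin.tsum_eq] at h2
  rw [h1, one_div]
  refine (hasSum_toFun (ker w) z).unique ?_
  convert h2 using 2 with α
  have hm := multinomial_pos' α
  have hsq : (√(α.multinomial : ℝ) : ℂ) * (√(α.multinomial : ℝ) : ℂ) = α.multinomial := by
    rw [← Complex.ofReal_mul, Real.mul_self_sqrt hm.le]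
    simp
  change (√(α.multinomial : ℝ) : ℂ) *
    ((√(α.multinomial : ℝ) : ℂ) * star (daMonomial α w.1)) * daMonomial α z.1 = _
  rw [← mul_assoc, hsq, mul_assoc]
  congr 1
  rw [daMonomial, daMonomial, Finsupp.prod, Finsupp.prod, Finsupp.prod, star_prod,
    ← Finset.prod_mul_distrib]
  refine Finset.prod_congr rfl fun i _ => ?_
  simp [mul_pow, mul_comm]

end DruryArveson

end

open scoped ComplexOrder

noncomputable section

/-! ### Gram matrices over arbitrary index sets and contractions between Hilbert spaces. -/

section Gram

variable {S K₁ K₂ : Type*} [NormedAddCommGroup K₁] [InnerProductSpace ℂ K₁]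
  [NormedAddCommGroup K₂] [InnerProductSpace ℂ K₂]

/-! Necessity: the adjoint of multiplication by `Φ` sends `k_z ⊗ v` to `k_z ⊗ Φ(z)* v`, so
contractivity of `Φ` amounts to positivity of its Pick kernel (`isContractiveMultiplier_iff`). The
Pick matrix is a finite submatrix of that kernel.

Sufficiency is the lurking isometry argument. Factor the Pick matrix as the Gram matrix of vectors
`b_p`, `p = (i, a)`. Since `1/k = 1 - ⟨z, w⟩`, clearing the kernel and moving negative terms across
shows that the vectors `e_a ⊕ (x̄_i ⊗ b_p)` and `W_i* e_a ⊕ b_p` have the same Gram matrix, so a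
contraction `T` maps the former to the latter. For every `z` in the ball, `‖z‖ < 1` makes the state
equation `f = snd T(e_a ⊕ (z̄ ⊗ f))` uniquely solvable (`existsUnique_state`), and the first
component of the output defines `Φ(z)* e_a`. Uniqueness recovers `b_p` at `x_i`, hence `Φ(x_i) =
W_i`. The Schur product theorem makes `Φ` contractive (`isContractiveMultiplier_transfer`). -/

theorem finsuppSum_gram (u : S → K₁) (c : S →₀ ℂ) :
    (c.sum fun i xi => c.sum fun j xj => star xi * Matrix.gram ℂ u i j * xj) =
      (‖Finsupp.linearCombination ℂ u c‖ : ℂ) ^ 2 := by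
  refine Eq.trans ?_ (inner_self_eq_norm_sq_to_K (𝕜 := ℂ) (Finsupp.linearCombination ℂ u c))
  rw [ Finsupp.linearCombination_apply, Finsupp.sum_inner]
  refine Finsupp.sum_congr fun i _ => ?_
  rw [Finsupp.inner_sum]
  refine Finsupp.sum_congr fun j _ => ?_
  simp only [Matrix.gram_apply, inner_smul_left, inner_smul_right, RCLike.star_def]
  ring

/-- The quadratic form of the difference at `c` is the difference of the two squared norms. -/
theorem posSemidef_gram_sub_gram_iff (u : S → K₁) (w : S → K₂) :
    (Matrix.gram ℂ u - Matrix.gram ℂ w).PosSemidef ↔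
      ∀ c : S →₀ ℂ, ‖Finsupp.linearCombination ℂ w c‖ ≤ ‖Finsupp.linearCombination ℂ u c‖ := by
  have key : ∀ c : S →₀ ℂ, (c.sum fun i xi => c.sum fun j xj =>
      star xi * (Matrix.gram ℂ u - Matrix.gram ℂ w) i j * xj) =
      ((‖Finsupp.linearCombination ℂ u c‖ ^ 2 -
        ‖Finsupp.linearCombination ℂ w c‖ ^ 2 : ℝ) : ℂ) := by
    intro c
    push_cast
    rw [← finsuppSum_gram, ← finsuppSum_gram, ← Finsupp.sum_sub]
    refine Finsupp.sum_congr fun i _ => ?_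
    rw [← Finsupp.sum_sub]
    refine Finsupp.sum_congr fun j _ => ?_
    rw [Matrix.sub_apply]
    ring
  rw [Matrix.PosSemidef, and_iff_right
    ((Matrix.isHermitian_gram ℂ u).sub (Matrix.isHermitian_gram ℂ w))]
  refine forall_congr' fun c => ?_
  rw [key, Complex.zero_le_real, sub_nonneg, sq_le_sq₀ (norm_nonneg _) (norm_nonneg _)]

/-- A Gram matrix is positive semi-definite, over an arbitrary index set. -/
theorem posSemidef_gram' (u : S → K₁) : (Matrix.gram ℂ u).PosSemidef := by
  have h := (posSemidef_gram_sub_gram_iff u (0 : S → K₁)).2 fun c => by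
    simp [Finsupp.linearCombination_apply]
  simpa using h

/-- A continuous linear contraction applied to a family of vectors decreases its Gram matrix. -/
theorem posSemidef_gram_sub_gram_map (u : S → K₁) (T : K₁ →L[ℂ] K₂) (hT : ∀ x, ‖T x‖ ≤ ‖x‖) :
    (Matrix.gram ℂ u - Matrix.gram ℂ fun s => T (u s)).PosSemidef := by
  refine (posSemidef_gram_sub_gram_iff _ _).2 fun c => ?_
  refine le_of_eq_of_le (congrArg _ ?_) (hT _)
  simp [Finsupp.linearCombination_apply, map_finsuppSum]

/-- If the Gram matrix of `u` dominates that of `w`, then `u s ↦ w s` extends to a contraction. -/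
theorem exists_contraction_of_posSemidef_gram_sub_gram [CompleteSpace K₁] [CompleteSpace K₂]
    (u : S → K₁) (w : S → K₂) (h : (Matrix.gram ℂ u - Matrix.gram ℂ w).PosSemidef) :
    ∃ T : K₁ →L[ℂ] K₂, (∀ x, ‖T x‖ ≤ ‖x‖) ∧ ∀ s, T (u s) = w s := by
  rw [posSemidef_gram_sub_gram_iff] at h
  let M : Submodule ℂ K₁ := (LinearMap.range (Finsupp.linearCombination ℂ u)).topologicalClosure
  have : CompleteSpace M := (Submodule.isClosed_topologicalClosure _).completeSpace_coe
  let e : (S →₀ ℂ) →ₗ[ℂ] M := (Finsupp.linearCombination ℂ u).codRestrict M fun c =>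
    Submodule.le_topologicalClosure _ ⟨c, rfl⟩
  -- Density of the combinations of the `u s` in `M` is what lets the norm bound determine a map on
  -- all of `M`.
  have hd : DenseRange e := by
    intro x
    rw [closure_subtype]
    have hx : (x : K₁) ∈ closure (Set.range (Finsupp.linearCombination ℂ u)) := x.2
    convert hx using 2
    ext y
    constructor
    · rintro ⟨_, ⟨c, rfl⟩, rfl⟩
      exact ⟨c, rfl⟩
    · rintro ⟨c, rfl⟩
      exact ⟨e c, ⟨c, rfl⟩, rfl⟩
  have hn : ∀ c, ‖Finsupp.linearCombination ℂ w c‖ ≤ 1 * ‖e c‖ := fun c => by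
    rw [one_mul]
    exact h c
  let T := (Finsupp.linearCombination ℂ w).extendOfNorm e
  -- Extension by zero on the orthogonal complement of `M`.
  refine ⟨T ∘L M.orthogonalProjectionOnto, fun x => ?_, fun s => ?_⟩
  · refine (LinearMap.norm_extendOfNorm_apply_le hd 1 hn _).trans ?_
    rw [one_mul]
    exact M.norm_orthogonalProjectionOnto_apply_le x
  · have hu : u s = (e (Finsupp.single s 1) : K₁) := by simp [e]
    rw [ContinuousLinearMap.comp_apply, hu, Submodule.orthogonalProjectionOnto_mem_subspace_eq_self]
    simpa using LinearMap.extendOfNorm_eq hd ⟨1, hn⟩ (Finsupp.single s 1)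

/-- Each test vector has finite support and the Hermitian condition involves two indices at a time,
so everything is seen on finite submatrices. -/
theorem Matrix.PosSemidef.of_submatrix_finset {M : Matrix S S ℂ}
    (h : ∀ s : Finset S, (M.submatrix ((↑) : s → S) (↑)).PosSemidef) : M.PosSemidef := by
  classical
  refine ⟨?_, fun c => ?_⟩
  · ext i j
    have := (h {i, j}).1.apply ⟨i, by simp⟩ ⟨j, by simp⟩
    simpa using this
  · have := (h c.support).dotProduct_mulVec_nonneg fun i => c i
    refine this.trans_eq ?_
    simp only [dotProduct, Matrix.mulVec, Finsupp.sum, Matrix.submatrix_apply, Pi.star_apply]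
    rw [← Finset.sum_coe_sort c.support]
    refine Finset.sum_congr rfl fun i _ => ?_
    rw [← Finset.sum_coe_sort c.support, Finset.mul_sum]
    exact Finset.sum_congr rfl fun j _ => by ring

/-- The Schur product theorem, over an arbitrary index set. -/
theorem Matrix.PosSemidef.hadamard' {A B : Matrix S S ℂ} (hA : A.PosSemidef)
    (hB : B.PosSemidef) : (A.hadamard B).PosSemidef := by
  classical
  exact .of_submatrix_finset fun s => (hA.submatrix (fun i : s => (i : S))).hadamard (hB.submatrix _)

end Gram

/-! ### Contractive multipliers and positivity of the Pick kernel. -/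

section Multiplier

variable {X : Type*} (H : Type*) [NormedAddCommGroup H] [InnerProductSpace ℂ H] [RKHS ℂ H X ℂ]
  [CompleteSpace H]

/-- The elementary tensor `k_z ⊗ v` of a kernel function and a vector, in `H ⊗ ℂᵐ`. -/
def kernelTensor {m : ℕ} (z : X) (v : EuclideanSpace ℂ (Fin m)) : PiLp 2 (fun _ : Fin m => H) :=
  WithLp.toLp 2 fun a => v a • RKHS.kerFun H z 1

/-- The vector `W* e_a`. -/
def adjointColumn {m : ℕ} (W : Matrix (Fin m) (Fin m) ℂ) (a : Fin m) : EuclideanSpace ℂ (Fin m) :=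
  WithLp.toLp 2 fun b => star (W a b)

theorem inner_kernelTensor {m : ℕ} (z : X) (v : EuclideanSpace ℂ (Fin m))
    (h : PiLp 2 (fun _ : Fin m => H)) :
    inner ℂ (kernelTensor H z v) h = ∑ a, star (v a) * h a z := by
  simp [kernelTensor, PiLp.inner_apply, inner_smul_left]

theorem inner_kernelTensor_single {m : ℕ} (z : X) (a : Fin m) (h : PiLp 2 (fun _ : Fin m => H)) :
    inner ℂ (kernelTensor H z (EuclideanSpace.single a 1)) h = h a z := by
  rw [inner_kernelTensor, Finset.sum_eq_single a] <;> simp +contextual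

/-- With `W = Φ z` the right side is the `a`-th entry of `(Φ h)(z)`; this is the adjoint relation
`M_Φ* (k_z ⊗ e_a) = k_z ⊗ Φ(z)* e_a` in weak form. -/
theorem inner_kernelTensor_adjointColumn {m : ℕ} (z : X) (W : Matrix (Fin m) (Fin m) ℂ)
    (a : Fin m) (h : PiLp 2 (fun _ : Fin m => H)) :
    inner ℂ (kernelTensor H z (adjointColumn W a)) h = ∑ b, W a b * h b z := by
  simp [inner_kernelTensor, adjointColumn]

theorem inner_kernelTensor_kernelTensor {m : ℕ} (z w : X) (v v' : EuclideanSpace ℂ (Fin m)) :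
    inner ℂ (kernelTensor H z v) (kernelTensor H w v') =
      inner ℂ v v' * RKHS.kernel H z w 1 := by
  rw [inner_kernelTensor, PiLp.inner_apply, Finset.sum_mul]
  refine Finset.sum_congr rfl fun a _ => ?_
  simp [kernelTensor, RKHS.kerFun_apply]
  ring

theorem inner_adjointColumn {m : ℕ} (V W : Matrix (Fin m) (Fin m) ℂ) (a b : Fin m) :
    inner ℂ (adjointColumn V a) (adjointColumn W b) = (V * W.conjTranspose) a b := by
  simp [adjointColumn, PiLp.inner_apply, Matrix.mul_apply, mul_comm]

theorem inner_single_single {m : ℕ} (a b : Fin m) :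
    inner ℂ (EuclideanSpace.single a (1 : ℂ)) (EuclideanSpace.single b 1) =
      (1 : Matrix (Fin m) (Fin m) ℂ) a b := by
  simp [EuclideanSpace.inner_single_left, Matrix.one_apply]

/-- The Pick kernel `((1 - Φ(z) Φ(w)*) k(z, w))_{ab}` of a matrix-valued function. -/
def pickKernel {m : ℕ} (Φ : X → Matrix (Fin m) (Fin m) ℂ) : Matrix (X × Fin m) (X × Fin m) ℂ :=
  Matrix.of fun p q =>
    (1 - Φ p.1 * (Φ q.1).conjTranspose) p.2 q.2 * RKHS.kernel H p.1 q.1 1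

theorem pickKernel_eq_gram_sub_gram {m : ℕ} (Φ : X → Matrix (Fin m) (Fin m) ℂ) :
    pickKernel H Φ =
      Matrix.gram ℂ (fun p : X × Fin m => kernelTensor H p.1 (EuclideanSpace.single p.2 1)) -
      Matrix.gram ℂ (fun p : X × Fin m => kernelTensor H p.1 (adjointColumn (Φ p.1) p.2)) := by
  ext p q
  rw [Matrix.sub_apply, Matrix.gram_apply, Matrix.gram_apply, inner_kernelTensor_kernelTensor,
    inner_kernelTensor_kernelTensor, inner_adjointColumn, inner_single_single, ← sub_mul]
  rfl

theorem RKHS.finset_sum_apply {H} [NormedAddCommGroup H] [InnerProductSpace ℂ H] [RKHS ℂ H X ℂ]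
    {J : Type*} (s : Finset J) (f : J → H) (x : X) :
    (∑ j ∈ s, f j) x = ∑ j ∈ s, f j x := by
  have h := map_sum (RKHS.coeCLM ℂ (H := H)) f s
  exact (congrFun h x).trans (Finset.sum_apply x s _)

/-- A matrix-valued function is a contractive multiplier if and only if its Pick kernel is
positive semi-definite. -/
theorem isContractiveMultiplier_iff {m : ℕ} (Φ : X → Matrix (Fin m) (Fin m) ℂ) :
    IsContractiveMultiplier H Φ ↔ (pickKernel H Φ).PosSemidef := by
  rw [pickKernel_eq_gram_sub_gram]
  constructor
  · rintro ⟨hΦ, hc⟩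
    refine (posSemidef_gram_sub_gram_iff _ _).2 fun c => ?_
    set w := Finsupp.linearCombination ℂ
      (fun p : X × Fin m => kernelTensor H p.1 (adjointColumn (Φ p.1) p.2)) c with hw
    set u := Finsupp.linearCombination ℂ
      (fun p : X × Fin m => kernelTensor H p.1 (EuclideanSpace.single p.2 (1 : ℂ))) c with hu
    choose G hG using fun a b => hΦ a b (w b)
    let g : PiLp 2 (fun _ : Fin m => H) := WithLp.toLp 2 fun a => ∑ b, G a b
    have hg : ∀ x a, g a x = ∑ b, Φ x a b * w b x := fun x a => by
      simp [g, RKHS.finset_sum_apply, hG]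
    -- Formally `w = M_Φ* u` and `g = M_Φ w`. Working with this single pair avoids constructing
    -- `M_Φ` as a bounded operator.
    have h1 : inner ℂ w w = inner ℂ u g := by
      conv_lhs => enter [2]; rw [hw]
      rw [hu, Finsupp.linearCombination_apply, Finsupp.linearCombination_apply,
        Finsupp.sum_inner, Finsupp.sum_inner]
      refine Finsupp.sum_congr fun p _ => ?_
      rw [inner_smul_left, inner_smul_left, inner_kernelTensor_single,
        inner_kernelTensor_adjointColumn, hg]
    have h2 : ‖w‖ * ‖w‖ ≤ ‖u‖ * ‖w‖ := by
      rw [← inner_self_eq_norm_mul_norm (𝕜 := ℂ), h1]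
      exact ((RCLike.re_le_norm _).trans (norm_inner_le_norm _ _)).trans (by gcongr; exact hc w g hg)
    rcases (norm_nonneg w).eq_or_lt with h0 | h0
    · rw [← h0]
      exact norm_nonneg _
    · exact le_of_mul_le_mul_right h2 h0
  · intro h
    obtain ⟨T, hT, hTu⟩ := exists_contraction_of_posSemidef_gram_sub_gram _ _ h
    -- The adjoint of `T` is multiplication by `Φ`.
    have hM : ∀ f a x, T.adjoint f a x = ∑ b, Φ x a b * f b x := fun f a x => by
      rw [← inner_kernelTensor_single, ContinuousLinearMap.adjoint_inner_right, hTu (x, a),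
        inner_kernelTensor_adjointColumn]
    -- Feeding in `f` in coordinate `b` alone isolates the entry `Φ_ab`.
    refine ⟨fun a b f => ⟨T.adjoint (WithLp.toLp 2 (Pi.single b f)) a, fun x => ?_⟩,
      fun f g hg => ?_⟩
    · rw [hM, Finset.sum_eq_single b] <;> simp +contextual
    · have : g = T.adjoint f := by
        ext a : 1
        refine RKHS.ext fun x => ?_
        rw [hg, hM]
      rw [this]
      have h1 : ‖T‖ ≤ 1 := T.opNorm_le_bound zero_le_one fun x => by simpa using hT x
      calc _ ≤ ‖T.adjoint‖ * ‖f‖ := T.adjoint.le_opNorm f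
        _ ≤ 1 * ‖f‖ := by
          gcongr
          rwa [LinearIsometryEquiv.norm_map]
        _ = ‖f‖ := one_mul _

theorem pickMatrix_eq_submatrix {m n : ℕ} (x : Fin n → X) (Φ : X → Matrix (Fin m) (Fin m) ℂ)
    (W : Fin n → Matrix (Fin m) (Fin m) ℂ) (h : ∀ i, Φ (x i) = W i) :
    pickMatrix H x W =
      (pickKernel H Φ).submatrix (fun p => (x p.1, p.2)) (fun p => (x p.1, p.2)) := by
  ext p q
  simp [pickMatrix, pickKernel, h]

end Multiplier

/-! ### Conjugate tensors and solvability of the state equation. -/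

section Realization

variable {ι F : Type*} [NormedAddCommGroup F] [InnerProductSpace ℂ F]

theorem memℓp_conjTensor (z : lp (fun _ : ι => ℂ) 2) (f : F) :
    Memℓp (fun i => star (z i) • f) 2 := by
  refine memℓp_gen ?_
  have h := (lp.hasSum_norm (p := 2) (by norm_num) z).summable.mul_right (‖f‖ ^ 2)
  refine h.congr fun i => ?_
  simp [norm_smul, mul_pow]

/-- The elementary tensor `z̄ ⊗ f` in `ℓ²(ι) ⊗ F`. -/
def conjTensor (z : lp (fun _ : ι => ℂ) 2) (f : F) : lp (fun _ : ι => F) 2 :=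
  ⟨_, memℓp_conjTensor z f⟩

theorem conjTensor_apply (z : lp (fun _ : ι => ℂ) 2) (f : F) (i : ι) :
    conjTensor z f i = star (z i) • f := rfl

/-- Conjugating `z` reverses the order in the scalar factor, which then matches `inner ℂ w z` in the
kernel `1 / (1 - inner ℂ w z)`. -/
theorem inner_conjTensor (z w : lp (fun _ : ι => ℂ) 2) (f g : F) :
    inner ℂ (conjTensor z f) (conjTensor w g) = inner ℂ w z * inner ℂ f g := by
  have h := (lp.hasSum_inner (𝕜 := ℂ) w z).mul_right (inner ℂ f g)
  refine (lp.hasSum_inner (conjTensor z f) (conjTensor w g)).unique ?_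
  refine (congrArg (HasSum · _) (funext fun i => ?_)).mp h
  rw [conjTensor_apply, conjTensor_apply, inner_smul_left, inner_smul_right]
  simp
  ring

theorem norm_conjTensor (z : lp (fun _ : ι => ℂ) 2) (f : F) :
    ‖conjTensor z f‖ = ‖z‖ * ‖f‖ := by
  have h := inner_conjTensor z z f f
  simp only [inner_self_eq_norm_sq_to_K] at h
  rw [← sq_eq_sq₀ (norm_nonneg _) (by positivity), mul_pow]
  exact_mod_cast h

/-- The map `f ↦ z̄ ⊗ f`. -/
def conjTensorL (z : lp (fun _ : ι => ℂ) 2) : F →L[ℂ] lp (fun _ : ι => F) 2 :=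
  LinearMap.mkContinuous
    { toFun := conjTensor z
      map_add' := fun f g => by
        ext i
        simp [conjTensor_apply]
      map_smul' := fun c f => by
        ext i
        simp [conjTensor_apply, smul_comm c] }
    ‖z‖ fun f => (norm_conjTensor z f).le

/-- The operator `1 - D` is invertible by the Neumann series. -/
theorem existsUnique_eq_add_of_norm_lt_one [CompleteSpace F] (D : F →L[ℂ] F) (hD : ‖D‖ < 1)
    (c : F) : ∃! f, f = c + D f := by
  obtain ⟨U, hU⟩ := isUnit_one_sub_of_norm_lt_one hD
  have h : ∀ f, f = c + D f ↔ (U : F →L[ℂ] F) f = c := fun f => by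
    rw [hU, sub_apply, one_apply_eq_self, sub_eq_iff_eq_add]
  simp only [h]
  refine ⟨(↑U⁻¹ : F →L[ℂ] F) c, ?_, fun f hf => ?_⟩
  · exact DFunLike.congr_fun U.mul_inv c
  · rw [← hf]
    exact (DFunLike.congr_fun U.inv_mul f).symm

variable {E : Type*} [NormedAddCommGroup E] [InnerProductSpace ℂ E]

/-- By linearity the equation reads `f = c + D f`, where `D f = snd T(0 ⊕ (z̄ ⊗ f))` has norm at
most `‖z‖ < 1`. -/
theorem existsUnique_state [CompleteSpace F]
    (T : WithLp 2 (E × lp (fun _ : ι => F) 2) →L[ℂ] WithLp 2 (E × F)) (hT : ∀ x, ‖T x‖ ≤ ‖x‖)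
    (z : DABall ι) (e : E) :
    ∃! f : F, f = (T (WithLp.toLp 2 (e, conjTensor z.1 f))).snd := by
  let D : F →ₗ[ℂ] F :=
    { toFun := fun f => (T (WithLp.toLp 2 (0, conjTensorL z.1 f))).snd
      map_add' := fun f g => by
        rw [← WithLp.add_snd, ← map_add, ← WithLp.toLp_add]
        simp
      map_smul' := fun c f => by
        rw [RingHom.id_apply, ← WithLp.smul_snd, ← map_smul, ← WithLp.toLp_smul]
        simp }
  have hD : ∀ f, ‖D f‖ ≤ ‖z.1‖ * ‖f‖ := fun f => by
    refine (WithLp.norm_snd_le _ _).trans ((hT _).trans ?_)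
    rw [WithLp.norm_toLp_snd]
    exact (norm_conjTensor _ _).le
  have hz : ‖z.1‖ < 1 := mem_ball_zero_iff.1 z.2
  have h := existsUnique_eq_add_of_norm_lt_one (D.mkContinuous _ hD)
    ((D.mkContinuous_norm_le (norm_nonneg _) hD).trans_lt hz) (T (WithLp.toLp 2 (e, 0))).snd
  convert h using 3 with f
  change _ = _ + (T (WithLp.toLp 2 (0, conjTensor z.1 f))).snd
  rw [← WithLp.add_snd, ← map_add, ← WithLp.toLp_add]
  simp

end Realization

/-! ### Transfer functions and interpolation on the ball. -/

namespace DruryArveson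

variable {ι : Type*}

theorem one_sub_inner_ne_zero (z w : DABall ι) : 1 - inner ℂ w.1 z.1 ≠ 0 := by
  intro h
  have h1 : ‖inner ℂ w.1 z.1‖ = 1 := by rw [← sub_eq_zero.1 h, norm_one]
  have hz : ‖z.1‖ < 1 := mem_ball_zero_iff.1 z.2
  have hw : ‖w.1‖ < 1 := mem_ball_zero_iff.1 w.2
  have := norm_inner_le_norm (𝕜 := ℂ) w.1 z.1
  nlinarith [norm_nonneg z.1, norm_nonneg w.1]

/-- The transfer function of a contraction `E ⊕ (ℓ² ⊗ F) → E ⊕ F`, with states `G`, is a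
contractive multiplier. -/
theorem isContractiveMultiplier_transfer {F : Type*} [NormedAddCommGroup F]
    [InnerProductSpace ℂ F] {m : ℕ}
    (T : WithLp 2 (EuclideanSpace ℂ (Fin m) × lp (fun _ : ι => F) 2) →L[ℂ]
      WithLp 2 (EuclideanSpace ℂ (Fin m) × F)) (hT : ∀ x, ‖T x‖ ≤ ‖x‖)
    (Φ : DABall ι → Matrix (Fin m) (Fin m) ℂ) (G : DABall ι × Fin m → F)
    (h : ∀ p, T (WithLp.toLp 2 (EuclideanSpace.single p.2 1, conjTensor p.1.1 (G p))) =
      WithLp.toLp 2 (adjointColumn (Φ p.1) p.2, G p)) :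
    IsContractiveMultiplier (DruryArveson ι) Φ := by
  rw [isContractiveMultiplier_iff]
  have h1 := posSemidef_gram_sub_gram_map (fun p : DABall ι × Fin m => WithLp.toLp 2
    (EuclideanSpace.single p.2 (1 : ℂ), conjTensor p.1.1 (G p))) T hT
  -- `h1` says `(1 - Φ(z)Φ(w)*) - (1 - ⟨z, w⟩)⟨G, G⟩ ≥ 0`. Multiplying entrywise by `k` turns the
  -- subtracted term into the Gram matrix of `G`; adding it back leaves the Pick kernel.
  have h2 := (h1.hadamard' (posSemidef_gram' fun p : DABall ι × Fin m =>
    RKHS.kerFun (DruryArveson ι) p.1 1)).add (posSemidef_gram' G)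
  convert h2 using 1
  ext p q
  have hne := one_sub_inner_ne_zero p.1 q.1
  have hk : inner ℂ (RKHS.kerFun (DruryArveson ι) p.1 1) (RKHS.kerFun (DruryArveson ι) q.1 1) =
      1 / (1 - inner ℂ q.1.1 p.1.1) := by
    rw [RKHS.kerFun_inner, RKHS.kerFun_apply, kernel_apply_one]
    simp
  rw [Matrix.add_apply, Matrix.hadamard_apply, Matrix.sub_apply, Matrix.gram_apply,
    Matrix.gram_apply, Matrix.gram_apply, Matrix.gram_apply, hk, h, h, WithLp.prod_inner_apply,
    WithLp.prod_inner_apply]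
  simp only [inner_conjTensor, inner_adjointColumn, inner_single_single]
  rw [pickKernel, Matrix.of_apply, kernel_apply_one, Matrix.sub_apply]
  field_simp
  ring

open scoped MatrixOrder Matrix.Norms.L2Operator in
/-- Positivity of the Pick matrix suffices for interpolation: the data are realized by a
contraction (the lurking isometry), whose transfer function is the interpolant. -/
theorem exists_isContractiveMultiplier {m n : ℕ} (x : Fin n → DABall ι)
    (W : Fin n → Matrix (Fin m) (Fin m) ℂ)
    (h : (pickMatrix (DruryArveson ι) x W).PosSemidef) :
    ∃ Φ : DABall ι → Matrix (Fin m) (Fin m) ℂ,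
      IsContractiveMultiplier (DruryArveson ι) Φ ∧ ∀ i, Φ (x i) = W i := by
  classical
  obtain ⟨B, hB⟩ := CStarAlgebra.nonneg_iff_eq_star_mul_self.mp h.nonneg
  let b : Fin n × Fin m → EuclideanSpace ℂ (Fin n × Fin m) := fun p => WithLp.toLp 2 fun r => B r p
  have hb : ∀ p q, inner ℂ (b p) (b q) * (1 - inner ℂ (x q.1).1 (x p.1).1) =
      (1 - W p.1 * (W q.1).conjTranspose) p.2 q.2 := fun p q => by
    have h1 : inner ℂ (b p) (b q) = pickMatrix (DruryArveson ι) x W p q := by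
      rw [hB]
      simp [b, PiLp.inner_apply, Matrix.mul_apply, mul_comm]
    have := one_sub_inner_ne_zero (x p.1) (x q.1)
    rw [h1, pickMatrix, Matrix.of_apply, kernel_apply_one]
    field_simp
  obtain ⟨T, hT, hTu⟩ := exists_contraction_of_posSemidef_gram_sub_gram
    (fun p : Fin n × Fin m => WithLp.toLp 2
      (EuclideanSpace.single p.2 (1 : ℂ), conjTensor (x p.1).1 (b p)))
    (fun p : Fin n × Fin m => WithLp.toLp 2 (adjointColumn (W p.1) p.2, b p)) (by
      -- The two Gram matrices coincide: this is `hb` rearranged.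
      convert Matrix.PosSemidef.zero using 1
      ext p q
      rw [Matrix.sub_apply, Matrix.gram_apply, Matrix.gram_apply, WithLp.prod_inner_apply,
        WithLp.prod_inner_apply]
      simp only [inner_conjTensor, inner_adjointColumn, inner_single_single, Matrix.zero_apply]
      have := hb p q
      rw [Matrix.sub_apply] at this
      linear_combination -this)
  choose G hG hG' using fun p : DABall ι × Fin m =>
    existsUnique_state T hT p.1 (EuclideanSpace.single p.2 (1 : ℂ))
  let Φ : DABall ι → Matrix (Fin m) (Fin m) ℂ := fun z => Matrix.of fun a c =>
    star ((T (WithLp.toLp 2 (EuclideanSpace.single a 1, conjTensor z.1 (G (z, a))))).fst c)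
  refine ⟨Φ, isContractiveMultiplier_transfer T hT Φ G fun p => ?_, fun i => ?_⟩
  · refine WithLp.ofLp_injective 2 (Prod.ext ?_ (hG p).symm)
    ext c
    simp [adjointColumn, Φ]
  · ext a c
    -- The relation `hTu` makes `b (i, a)` a solution of the state equation at `x i`, so uniqueness
    -- applies.
    have hi : b (i, a) = G (x i, a) := hG' (x i, a) _ (congrArg WithLp.snd (hTu (i, a))).symm
    change star ((T (WithLp.toLp 2 (EuclideanSpace.single a 1,
      conjTensor (x i).1 (G (x i, a))))).fst c) = _
    rw [← hi, hTu (i, a)]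
    simp [adjointColumn]

end DruryArveson

end

theorem mainTheorem5 (ι : Type*) [Countable ι] :
    HasCompletePickProperty (DruryArveson ι) := by
  intro m n x W
  refine ⟨?_, DruryArveson.exists_isContractiveMultiplier x W⟩
  rintro ⟨Φ, hΦ, hW⟩
  rw [pickMatrix_eq_submatrix _ x Φ W hW]
  exact ((isContractiveMultiplier_iff _ Φ).1 hΦ).submatrix _
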